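/- Let $b,\tau,C>0$, let $q\in C[-b,b]$ be complex valued, and let $f$ be a nonvanishing solution of $f''-q(x)f=0$ on $(-b,b)$ with $f(0)=1$ and $f'(0)=\alpha\in\mathbb{C}$. Put $X^{(0)}\equiv\tilde X^{(0)}\equiv 1$ and, for $n\ge 1$, $$X^{(n)}(x)=n\int_0^x X^{(n-1)}(s)\,\bigl(f^2(s)\bigr)^{(-1)^n}ds,\qquad \tilde X^{(n)}(x)=n\int_0^x \tilde X^{(n-1)}(s)\,\bigl(f^2(s)\bigr)^{(-1)^{n-1}}ds,$$ and define the formal powers $\varphi_k=f\,X^{(k)}$ for $k$ odd and $\varphi_k=f\,\tilde X^{(k)}$ for $k$ even. The Holmgren class $H(\gamma_1,\gamma_2,C_1,t_0)$ is the set of infinitely differentiable complex-valued functions $v$ on $|t-t_0|<\gamma_2$ such that $|v^{(j)}(t)|\le C_1\gamma_1^{-2j}(2j)!$ for all $j=0,1,\dots$ and all $|t-t_0|<\gamma_2$. Let $F,G\in H(b,\tau,C,0)$ and let $u(x,t)$ be a complex-valued classical solution (that is, $u,u_x,u_{xx},u_t$ exist and are continuous on $(-b,b)\times(-\tau,\tau)$)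 of the noncharacteristic Cauchy problem $$u_{xx}(x,t)-q(x)u(x,t)=u_t(x,t)\quad(|x|<b,\ |t|<\tau),\qquad u(0,t)=F(t),\quad u_x(0,t)=G(t)\quad(|t|<\tau).$$ Then for every $r<b$ the series $$\sum_{j=0}^{\infty}\left[\frac{F^{(j)}(t)}{(2j)!}\left(\varphi_{2j}(x)-\frac{\alpha}{2j+1}\varphi_{2j+1}(x)\right)+\frac{G^{(j)}(t)}{(2j+1)!}\varphi_{2j+1}(x)\right]$$ converges absolutely at every point of, and uniformly on, the set $\{(x,t):|x|\le r,\ |t|<\tau\}$, and its sum is $u(x,t)$. -/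

import Mathlib

open Set Filter Topology
open scoped ContDiff

noncomputable section

/-- The recurrent integrals `X⁽ⁿ⁾` built from `f`: `X⁽⁰⁾ = 1` and
`X⁽ⁿ⁾(x) = n ∫₀ˣ X⁽ⁿ⁻¹⁾(s) (f(s)²)^((-1)ⁿ) ds`. -/
def recX (f : ℝ → ℂ) : ℕ → ℝ → ℂ
  | 0 => fun _ => 1
  | n + 1 => fun x =>
      ((n + 1 : ℕ) : ℂ) * ∫ s in (0 : ℝ)..x, recX f n s * (f s ^ 2) ^ ((-1 : ℤ) ^ (n + 1))

/-- The recurrent integrals `X̃⁽ⁿ⁾` built from `f`: `X̃⁽⁰⁾ = 1` and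
`X̃⁽ⁿ⁾(x) = n ∫₀ˣ X̃⁽ⁿ⁻¹⁾(s) (f(s)²)^((-1)ⁿ⁻¹) ds`. -/
def recXTilde (f : ℝ → ℂ) : ℕ → ℝ → ℂ
  | 0 => fun _ => 1
  | n + 1 => fun x =>
      ((n + 1 : ℕ) : ℂ) * ∫ s in (0 : ℝ)..x, recXTilde f n s * (f s ^ 2) ^ ((-1 : ℤ) ^ n)

/-- The formal powers `φ_k` associated with `f`. -/
def formalPower (f : ℝ → ℂ) (k : ℕ) (x : ℝ) : ℂ :=
  if Even k then f x * recXTilde f k x else f x * recX f k x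

/-- `f` is a nonvanishing solution of `f'' - q f = 0` on `(-b, b)` with
`f(0) = 1` and `f'(0) = α`. -/
structure IsNonvanishingSolution (q : ℝ → ℂ) (b : ℝ) (α : ℂ) (f : ℝ → ℂ) : Prop where
  differentiable : ∀ x ∈ Ioo (-b) b, DifferentiableAt ℝ f x
  equation : ∀ x ∈ Ioo (-b) b, HasDerivAt (deriv f) (q x * f x) x
  ne_zero : ∀ x ∈ Ioo (-b) b, f x ≠ 0
  value_zero : f 0 = 1
  deriv_zero : deriv f 0 = α

/-- The Holmgren class `H(γ₁, γ₂, C₁, t₀)`: functions that are infinitely differentiable on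
`|t - t₀| < γ₂` and satisfy `|v⁽ʲ⁾(t)| ≤ C₁ γ₁^(-2j) (2j)!` there, for all `j ≥ 0`. Functions are
total on `ℝ`; only their restrictions to `|t - t₀| < γ₂` matter. -/
def HolmgrenClass (γ₁ γ₂ C₁ t₀ : ℝ) : Set (ℝ → ℂ) :=
  {v | ContDiffOn ℝ ∞ v (Ioo (t₀ - γ₂) (t₀ + γ₂)) ∧
    ∀ j : ℕ, ∀ t ∈ Ioo (t₀ - γ₂) (t₀ + γ₂),
      ‖iteratedDeriv j v t‖ ≤ C₁ * (γ₁ ^ (2 * j))⁻¹ * ((2 * j).factorial : ℝ)}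

/-- `u` is a classical (`C^{2,1}`) solution of `u_xx - q(x) u = u_t` on `|x| < b`, `|t| < τ`:
the derivatives `u_x`, `u_xx`, `u_t` exist there, `u`, `u_x`, `u_xx`, `u_t` are jointly
continuous there, and the equation holds pointwise. -/
structure IsClassicalSolution (q : ℝ → ℂ) (b τ : ℝ) (u : ℝ → ℝ → ℂ) : Prop where
  differentiable_x : ∀ x ∈ Ioo (-b) b, ∀ t ∈ Ioo (-τ) τ,
    DifferentiableAt ℝ (fun y => u y t) x
  differentiable_xx : ∀ x ∈ Ioo (-b) b, ∀ t ∈ Ioo (-τ) τ,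
    DifferentiableAt ℝ (deriv (fun y => u y t)) x
  differentiable_t : ∀ x ∈ Ioo (-b) b, ∀ t ∈ Ioo (-τ) τ,
    DifferentiableAt ℝ (fun s => u x s) t
  continuousOn : ContinuousOn (fun p : ℝ × ℝ => u p.1 p.2) (Ioo (-b) b ×ˢ Ioo (-τ) τ)
  continuousOn_x : ContinuousOn (fun p : ℝ × ℝ => deriv (fun y => u y p.2) p.1)
    (Ioo (-b) b ×ˢ Ioo (-τ) τ)
  continuousOn_xx : ContinuousOn (fun p : ℝ × ℝ => deriv (deriv (fun y => u y p.2)) p.1)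
    (Ioo (-b) b ×ˢ Ioo (-τ) τ)
  continuousOn_t : ContinuousOn (fun p : ℝ × ℝ => deriv (fun s => u p.1 s) p.2)
    (Ioo (-b) b ×ˢ Ioo (-τ) τ)
  equation : ∀ x ∈ Ioo (-b) b, ∀ t ∈ Ioo (-τ) τ,
    deriv (deriv (fun y => u y t)) x - q x * u x t = deriv (fun s => u x s) t

/-- The `j`-th term of the series attached to the Cauchy data `F`, `G`. -/
def cauchySeriesTerm (f : ℝ → ℂ) (α : ℂ) (F G : ℝ → ℂ) (j : ℕ) (x t : ℝ) : ℂ :=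
  iteratedDeriv j F t / ((2 * j).factorial : ℂ) *
      (formalPower f (2 * j) x - α / ((2 * j + 1 : ℕ) : ℂ) * formalPower f (2 * j + 1) x) +
    iteratedDeriv j G t / ((2 * j + 1).factorial : ℂ) * formalPower f (2 * j + 1) x

end

/-!
The equation is solved in the direction of `x`. Let `f` be the nonvanishing solution of
`f'' = q f` and let `T g = f ∫₀ˣ f⁻² ∫₀ˢ f g` (`duhamel`), which inverts `y'' - q y = g` with zero
data at `0`. The formal powers satisfy `φ_{k+2} = (k+2)(k+1) T φ_k`, so that the terms of the series
are `F⁽ʲ⁾(t) Tʲc + G⁽ʲ⁾(t) Tʲs`, where `c`, `s` are the fundamental solutions of `y'' = q y`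
(`cauchySeriesTerm_eq`).

*Convergence.* On `|x| ≤ r` the logarithmic derivative of `f` is bounded by some `L`, and then
`|Tⁿg| ≤ sup |g| · |x|²ⁿ e^{L|x|} / (2n)!` (`norm_iterate_duhamel_le`). The Holmgren bounds on
`F⁽ʲ⁾`, `G⁽ʲ⁾` leave a geometric majorant of ratio `(r/b)²` (`exists_norm_cauchySeriesTerm_le`).

*Identification of the sum.* Variation of constants gives `u = F c + G s + T u_t`. Since `u` has
only one time derivative, this cannot be iterated pointwise. It is iterated after integration
against the weight `w = (s(1-s))ᴺ` on a short time interval: `w` vanishes to order `N` at the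
ends, so the derivatives move onto it, and the average of `u` equals the average of the `N`-th
partial sum plus `Tᴺ` of the moment of `u` against a multiple of `w⁽ᴺ⁾`
(`moment_eq_sum_add_remainder`). By Rodrigues' formula `|w⁽ᴺ⁾| ≤ N! 8ᴺ`, which is beaten by the
`(2N)!` gained from `Tᴺ`, even after division by `∫ w` (`tendsto_remainder`). The normalized
weights concentrate at the midpoint of the interval, so `u` and the sum of the series, both
continuous in `t`, agree there (`eq_of_tendstoUniformlyOn`). In particular no separate uniqueness
theorem is needed, and the series is never differentiated.
-/

/-! ### Solving the inhomogeneous equation by two quadratures -/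

lemma uIcc_zero_subset_Ioo {b x : ℝ} (hx : x ∈ Ioo (-b) b) : uIcc 0 x ⊆ Ioo (-b) b :=
  ordConnected_Ioo.uIcc_subset ⟨by linarith [hx.1, hx.2], by linarith [hx.1, hx.2]⟩ hx

lemma ContinuousOn.intervalIntegrable_zero_of_mem_Ioo {b x : ℝ} {g : ℝ → ℂ}
    (hg : ContinuousOn g (Ioo (-b) b)) (hx : x ∈ Ioo (-b) b) :
    IntervalIntegrable g MeasureTheory.volume 0 x :=
  (hg.mono (uIcc_zero_subset_Ioo hx)).intervalIntegrable

lemma ContinuousOn.hasDerivAt_integral_of_mem_Ioo {b x : ℝ} {g : ℝ → ℂ}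
    (hg : ContinuousOn g (Ioo (-b) b)) (hx : x ∈ Ioo (-b) b) :
    HasDerivAt (fun y => ∫ s in (0 : ℝ)..y, g s) (g x) x :=
  intervalIntegral.integral_hasDerivAt_right (hg.intervalIntegrable_zero_of_mem_Ioo hx)
    (hg.stronglyMeasurableAtFilter isOpen_Ioo x hx) (hg.continuousAt (isOpen_Ioo.mem_nhds hx))

lemma ContinuousOn.integral_of_Ioo {b : ℝ} {g : ℝ → ℂ} (hg : ContinuousOn g (Ioo (-b) b)) :
    ContinuousOn (fun x => ∫ s in (0 : ℝ)..x, g s) (Ioo (-b) b) :=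
  fun _ hx => (hg.hasDerivAt_integral_of_mem_Ioo hx).continuousAt.continuousWithinAt

/-- The operator `g ↦ f ∫₀ˣ f⁻² ∫₀ˢ f g`. When `f'' = q f` and `f` does not vanish, it sends `g` to
the solution `y` of `y'' - q y = g` with `y(0) = y'(0) = 0`. -/
noncomputable def duhamel (f g : ℝ → ℂ) (x : ℝ) : ℂ :=
  f x * ∫ s in (0 : ℝ)..x, (f s ^ 2)⁻¹ * ∫ σ in (0 : ℝ)..s, f σ * g σ

section Duhamel

variable {b : ℝ} {f : ℝ → ℂ}

lemma continuousOn_inv_sq_mul_integral (hf : ContinuousOn f (Ioo (-b) b))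
    (hf0 : ∀ x ∈ Ioo (-b) b, f x ≠ 0) {g : ℝ → ℂ} (hg : ContinuousOn g (Ioo (-b) b)) :
    ContinuousOn (fun s => (f s ^ 2)⁻¹ * ∫ σ in (0 : ℝ)..s, f σ * g σ) (Ioo (-b) b) :=
  ((hf.pow 2).inv₀ fun x hx => pow_ne_zero 2 (hf0 x hx)).mul (hf.mul hg).integral_of_Ioo

lemma continuousOn_duhamel (hf : ContinuousOn f (Ioo (-b) b))
    (hf0 : ∀ x ∈ Ioo (-b) b, f x ≠ 0) {g : ℝ → ℂ} (hg : ContinuousOn g (Ioo (-b) b)) :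
    ContinuousOn (duhamel f g) (Ioo (-b) b) :=
  hf.mul (continuousOn_inv_sq_mul_integral hf hf0 hg).integral_of_Ioo

lemma continuousOn_iterate_duhamel (hf : ContinuousOn f (Ioo (-b) b))
    (hf0 : ∀ x ∈ Ioo (-b) b, f x ≠ 0) {g : ℝ → ℂ} (hg : ContinuousOn g (Ioo (-b) b)) (n : ℕ) :
    ContinuousOn ((duhamel f)^[n] g) (Ioo (-b) b) := by
  induction n with
  | zero => exact hg
  | succ n ih => rw [Function.iterate_succ_apply']; exact continuousOn_duhamel hf hf0 ih

lemma duhamel_const_mul (c : ℂ) (g : ℝ → ℂ) :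
    duhamel f (fun x => c * g x) = fun x => c * duhamel f g x := by
  ext x
  simp only [duhamel, mul_left_comm _ c, intervalIntegral.integral_const_mul]

lemma duhamel_add (hf : ContinuousOn f (Ioo (-b) b)) (hf0 : ∀ x ∈ Ioo (-b) b, f x ≠ 0)
    {g h : ℝ → ℂ} (hg : ContinuousOn g (Ioo (-b) b)) (hh : ContinuousOn h (Ioo (-b) b))
    {x : ℝ} (hx : x ∈ Ioo (-b) b) :
    duhamel f (fun x => g x + h x) x = duhamel f g x + duhamel f h x := by
  unfold duhamel
  rw [← mul_add, ← intervalIntegral.integral_add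
    ((continuousOn_inv_sq_mul_integral hf hf0 hg).intervalIntegrable_zero_of_mem_Ioo hx)
    ((continuousOn_inv_sq_mul_integral hf hf0 hh).intervalIntegrable_zero_of_mem_Ioo hx)]
  congr 1
  refine intervalIntegral.integral_congr fun s hs => ?_
  have hs' := uIcc_zero_subset_Ioo hx hs
  beta_reduce
  rw [← mul_add, ← intervalIntegral.integral_add
    (f := fun σ => f σ * g σ) (g := fun σ => f σ * h σ)
    ((hf.mul hg).intervalIntegrable_zero_of_mem_Ioo hs')
    ((hf.mul hh).intervalIntegrable_zero_of_mem_Ioo hs')]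
  simp only [mul_add]

lemma duhamel_congr {g h : ℝ → ℂ} (hgh : EqOn g h (Ioo (-b) b)) :
    EqOn (duhamel f g) (duhamel f h) (Ioo (-b) b) := by
  intro x hx
  unfold duhamel
  congr 1
  refine intervalIntegral.integral_congr fun s hs => ?_
  congr 1
  refine intervalIntegral.integral_congr fun σ hσ => ?_
  rw [hgh (uIcc_zero_subset_Ioo (uIcc_zero_subset_Ioo hx hs) hσ)]

lemma iterate_duhamel_linear (hf : ContinuousOn f (Ioo (-b) b))
    (hf0 : ∀ x ∈ Ioo (-b) b, f x ≠ 0) {g c s h : ℝ → ℂ} {A B : ℂ}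
    (hc : ContinuousOn c (Ioo (-b) b)) (hs : ContinuousOn s (Ioo (-b) b))
    (hh : ContinuousOn h (Ioo (-b) b))
    (hg : EqOn g (fun x => A * c x + B * s x + h x) (Ioo (-b) b)) (n : ℕ) :
    EqOn ((duhamel f)^[n] g) (fun x => A * (duhamel f)^[n] c x + B * (duhamel f)^[n] s x +
      (duhamel f)^[n] h x) (Ioo (-b) b) := by
  induction n with
  | zero => exact hg
  | succ n ih =>
    simp only [Function.iterate_succ_apply']
    intro x hx
    have cc : ContinuousOn (fun x => A * (duhamel f)^[n] c x) (Ioo (-b) b) :=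
      (continuousOn_const (c := A)).mul (continuousOn_iterate_duhamel hf hf0 hc n)
    have cs : ContinuousOn (fun x => B * (duhamel f)^[n] s x) (Ioo (-b) b) :=
      (continuousOn_const (c := B)).mul (continuousOn_iterate_duhamel hf hf0 hs n)
    rw [duhamel_congr ih hx, duhamel_add (g := fun x => _) hf hf0 (cc.fun_add cs)
      (continuousOn_iterate_duhamel hf hf0 hh n) hx, duhamel_add hf hf0 cc cs hx,
      duhamel_const_mul, duhamel_const_mul]

/-- Iterating `J i = A i * c + B i * s + duhamel f (J (i + 1))` expresses `J 0` by a finite sum and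
a remainder, as in Taylor's formula. -/
lemma eq_sum_add_iterate_duhamel (hf : ContinuousOn f (Ioo (-b) b))
    (hf0 : ∀ x ∈ Ioo (-b) b, f x ≠ 0) {c s : ℝ → ℂ}
    (hc : ContinuousOn c (Ioo (-b) b)) (hs : ContinuousOn s (Ioo (-b) b))
    {J : ℕ → ℝ → ℂ} (hJ : ∀ i, ContinuousOn (J i) (Ioo (-b) b)) {A B : ℕ → ℂ} {N : ℕ}
    (h : ∀ i < N, EqOn (J i) (fun x => A i * c x + B i * s x + duhamel f (J (i + 1)) x)
      (Ioo (-b) b)) {x : ℝ} (hx : x ∈ Ioo (-b) b) :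
    J 0 x = ∑ i ∈ Finset.range N, (A i * (duhamel f)^[i] c x + B i * (duhamel f)^[i] s x) +
      (duhamel f)^[N] (J N) x := by
  induction N with
  | zero => simp
  | succ N ih =>
    rw [ih fun i hi => h i (by omega), iterate_duhamel_linear hf hf0 hc hs
      (continuousOn_duhamel hf hf0 (hJ _)) (h N (by omega)) N hx, Finset.sum_range_succ,
      Function.iterate_succ_apply]
    ring

end Duhamel

/-! ### Formal powers as iterates -/

lemma formalPower_add_two (f : ℝ → ℂ) (k : ℕ) (x : ℝ) :
    formalPower f (k + 2) x = ((k + 2 : ℕ) : ℂ) * ((k + 1 : ℕ) : ℂ) *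
      duhamel f (formalPower f k) x := by
  unfold duhamel formalPower
  rcases Nat.even_or_odd k with hk | hk
  · have h1 : Even (k + 2) := by simpa [Nat.even_add] using hk
    have h2 : (-1 : ℤ) ^ (k + 1) = -1 := hk.add_one.neg_one_pow
    have h3 : (-1 : ℤ) ^ k = 1 := hk.neg_one_pow
    simp only [h1, hk, if_true, recXTilde, h2, h3, zpow_one, zpow_neg, mul_assoc,
      intervalIntegral.integral_const_mul]
    rw [mul_left_comm (f x)]
    congr 1
    rw [mul_left_comm (f x)]
    congr 2
    refine intervalIntegral.integral_congr fun s _ => ?_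
    rw [mul_comm]
    congr 1
    refine intervalIntegral.integral_congr fun σ _ => ?_
    ring
  · have h1 : ¬ Even (k + 2) := by simpa [Nat.even_add] using hk
    have h0 : ¬ Even k := by simpa using hk
    have h2 : (-1 : ℤ) ^ (k + 1) = 1 := hk.add_one.neg_one_pow
    have h3 : (-1 : ℤ) ^ (k + 1 + 1) = -1 := hk.add_one.add_one.neg_one_pow
    simp only [h1, h0, if_false, recX, h2, h3, zpow_one, zpow_neg, mul_assoc,
      intervalIntegral.integral_const_mul]
    rw [mul_left_comm (f x)]
    congr 1
    rw [mul_left_comm (f x)]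
    congr 2
    refine intervalIntegral.integral_congr fun s _ => ?_
    rw [mul_comm]
    congr 1
    refine intervalIntegral.integral_congr fun σ _ => ?_
    ring

/-- The solution `φ₀ - α φ₁` of `y'' = q y`; if `f(0) = 1` and `f'(0) = α`, it has `y(0) = 1` and
`y'(0) = 0`. -/
noncomputable def cosSol (f : ℝ → ℂ) (α : ℂ) (x : ℝ) : ℂ :=
  formalPower f 0 x - α * formalPower f 1 x

/-- The solution `φ₁` of `y'' = q y`; if `f(0) = 1`, it has `y(0) = 0` and `y'(0) = 1`. -/
noncomputable def sinSol (f : ℝ → ℂ) (x : ℝ) : ℂ := formalPower f 1 x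

lemma formalPower_zero (f : ℝ → ℂ) (x : ℝ) : formalPower f 0 x = f x := by
  simp [formalPower, recXTilde]

lemma formalPower_one (f : ℝ → ℂ) (x : ℝ) :
    formalPower f 1 x = f x * ∫ s in (0 : ℝ)..x, (f s ^ 2)⁻¹ := by
  simp [formalPower, recX]

lemma iterate_duhamel_formalPower (f : ℝ → ℂ) (k j : ℕ) (x : ℝ) :
    ((k + 2 * j).factorial : ℂ) * (duhamel f)^[j] (formalPower f k) x =
      (k.factorial : ℂ) * formalPower f (k + 2 * j) x := by
  induction j generalizing x with
  | zero => simp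
  | succ j ih =>
    have h : (duhamel f)^[j] (formalPower f k) = fun x =>
        ((k.factorial : ℂ) / ((k + 2 * j).factorial : ℂ)) * formalPower f (k + 2 * j) x := by
      ext y
      have := ih y
      have h0 : ((k + 2 * j).factorial : ℂ) ≠ 0 := by exact_mod_cast Nat.factorial_ne_zero _
      field_simp
      linear_combination this
    have h0 : ((k + 2 * j).factorial : ℂ) ≠ 0 := by exact_mod_cast Nat.factorial_ne_zero _
    rw [Function.iterate_succ_apply', h, duhamel_const_mul, show k + 2 * (j + 1) = k + 2 * j + 2 by
      ring, formalPower_add_two, Nat.factorial_succ, Nat.factorial_succ]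
    push_cast
    field_simp
    ring

section

variable {b : ℝ} {f : ℝ → ℂ}

lemma continuousOn_formalPower_one (hf : ContinuousOn f (Ioo (-b) b))
    (hf0 : ∀ x ∈ Ioo (-b) b, f x ≠ 0) : ContinuousOn (formalPower f 1) (Ioo (-b) b) := by
  rw [show formalPower f 1 = _ from funext (formalPower_one f)]
  exact hf.mul ((hf.pow 2).inv₀ fun x hx => pow_ne_zero 2 (hf0 x hx)).integral_of_Ioo

lemma continuousOn_cosSol (hf : ContinuousOn f (Ioo (-b) b))
    (hf0 : ∀ x ∈ Ioo (-b) b, f x ≠ 0) (α : ℂ) : ContinuousOn (cosSol f α) (Ioo (-b) b) := by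
  unfold cosSol
  simp only [formalPower_zero]
  exact hf.sub (continuousOn_const.mul (continuousOn_formalPower_one hf hf0))

/-- The terms of the series are combinations of the iterates of `duhamel f` on the two
fundamental solutions. -/
lemma cauchySeriesTerm_eq (hf : ContinuousOn f (Ioo (-b) b)) (hf0 : ∀ x ∈ Ioo (-b) b, f x ≠ 0)
    (α : ℂ) (F G : ℝ → ℂ) (j : ℕ) {x : ℝ} (hx : x ∈ Ioo (-b) b) (t : ℝ) :
    cauchySeriesTerm f α F G j x t = iteratedDeriv j F t * (duhamel f)^[j] (cosSol f α) x +
      iteratedDeriv j G t * (duhamel f)^[j] (sinSol f) x := by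
  have h1 := continuousOn_formalPower_one hf hf0
  have h0 : ContinuousOn (formalPower f 0) (Ioo (-b) b) := by
    rwa [show formalPower f 0 = f from funext (formalPower_zero f)]
  have hc := iterate_duhamel_linear hf hf0 h0 h1 continuousOn_const (g := cosSol f α)
    (A := 1) (B := -α) (h := fun _ => 0) (fun y _ => by simp [cosSol, sub_eq_add_neg]) j hx
  have hz : (duhamel f)^[j] (fun _ => 0) x = 0 := by
    rw [Function.iterate_fixed]
    simpa using duhamel_const_mul (f := f) 0 (fun _ => 0)
  have e0 := iterate_duhamel_formalPower f 0 j x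
  have e1 := iterate_duhamel_formalPower f 1 j x
  have n0 : ((2 * j).factorial : ℂ) ≠ 0 := by exact_mod_cast Nat.factorial_ne_zero _
  have n1 : ((2 * j + 1 : ℕ) : ℂ) ≠ 0 := by exact_mod_cast Nat.succ_ne_zero (2 * j)
  rw [hc]
  beta_reduce
  rw [hz, show sinSol f = formalPower f 1 from rfl]
  simp only [zero_add, add_comm 1 (2 * j), Nat.factorial_zero, Nat.factorial_one, Nat.cast_one,
    one_mul] at e0 e1
  unfold cauchySeriesTerm
  rw [← e0, ← e1, Nat.factorial_succ, Nat.cast_mul]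
  field_simp
  ring

end

/-! ### Sharp bounds for the iterates -/

lemma norm_integral_zero_le_of_norm_le_pow {p : ℝ → ℂ} {B x : ℝ} {k : ℕ}
    (h : ∀ s ∈ uIoc 0 x, ‖p s‖ ≤ B * |s| ^ k) :
    ‖∫ s in (0 : ℝ)..x, p s‖ ≤ B * |x| ^ (k + 1) / (k + 1) := by
  rw [intervalIntegral.norm_intervalIntegral_eq]
  have hint : MeasureTheory.IntegrableOn (fun s : ℝ => B * |s| ^ k) (uIoc 0 x) := by
    have : Continuous fun s : ℝ => B * |s| ^ k := by fun_prop
    exact (this.intervalIntegrable 0 x).def'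
  refine (MeasureTheory.norm_integral_le_of_norm_le hint
    ((MeasureTheory.ae_restrict_iff' measurableSet_uIoc).2 (Eventually.of_forall h))).trans_eq ?_
  have := integral_pow_abs_sub_uIoc (a := 0) (b := x) (n := k)
  simp only [sub_zero] at this
  rw [MeasureTheory.integral_const_mul, this, mul_div_assoc]

/-- On a compact interval the logarithmic derivative of a nonvanishing `C¹` function is bounded, so
the function changes at most exponentially. -/
lemma exists_norm_le_norm_mul_exp {b r : ℝ} (hr : r < b) {f f' : ℝ → ℂ}
    (hf : ∀ x ∈ Ioo (-b) b, HasDerivAt f (f' x) x) (hf' : ContinuousOn f' (Ioo (-b) b))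
    (hf0 : ∀ x ∈ Ioo (-b) b, f x ≠ 0) :
    ∃ L : ℝ, 0 ≤ L ∧ ∀ x ∈ Icc (-r) r, ∀ s ∈ Icc (-r) r,
      ‖f s‖ ≤ ‖f x‖ * Real.exp (L * |x - s|) := by
  have hsub : Icc (-r) r ⊆ Ioo (-b) b := Icc_subset_Ioo (by linarith) hr
  have hfc : ContinuousOn f (Ioo (-b) b) := fun x hx => (hf x hx).continuousAt.continuousWithinAt
  obtain ⟨L, hL⟩ := (isCompact_Icc (a := -r) (b := r)).exists_bound_of_continuousOn
    ((hf'.div hfc hf0).mono hsub)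
  refine ⟨max L 0, le_max_right _ _, fun x hx s hs => ?_⟩
  have hmem : ∀ y ∈ Icc (0 : ℝ) 1, x + y * (s - x) ∈ Icc (-r) r := fun y hy =>
    (convex_Icc (-r) r).add_smul_sub_mem hx hs hy
  have hder : ∀ y ∈ Icc (0 : ℝ) 1, HasDerivAt (fun y : ℝ => f (x + y * (s - x)))
      ((s - x) • f' (x + y * (s - x))) y := fun y hy => by
    have h1 : HasDerivAt (fun y : ℝ => x + y * (s - x)) (s - x) y := by
      simpa using ((hasDerivAt_id y).mul_const (s - x)).const_add x
    exact (hf _ (hsub (hmem y hy))).scomp y h1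
  -- Grönwall's inequality along the segment from `x` to `s`.
  have := norm_le_gronwallBound_of_norm_deriv_right_le (δ := ‖f x‖) (K := max L 0 * |x - s|)
    (ε := 0) (a := 0) (b := 1)
    (fun y hy => (hder y hy).continuousAt.continuousWithinAt)
    (fun y hy => (hder y (Ico_subset_Icc_self hy)).hasDerivWithinAt) (by simp)
    (fun y hy => by
      have hy' := hmem y (Ico_subset_Icc_self hy)
      have h2 := hL _ hy'
      rw [Pi.div_apply, norm_div, div_le_iff₀ (norm_pos_iff.2 (hf0 _ (hsub hy')))] at h2
      rw [norm_smul, Real.norm_eq_abs, abs_sub_comm s x, add_zero, mul_comm (max L 0), mul_assoc]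
      gcongr
      exact h2.trans (by gcongr; exact le_max_left _ _)) 1 (by simp)
  simpa [gronwallBound_ε0] using this

lemma abs_sub_of_mem_uIoc_zero {s σ : ℝ} (h : σ ∈ uIoc 0 s) : |s - σ| = |s| - |σ| := by
  rcases mem_uIoc.1 h with h | h
  · rw [abs_of_nonneg (by linarith [h.2] : 0 ≤ s - σ), abs_of_pos h.1, abs_of_pos (by linarith)]
  · rw [abs_of_neg (by linarith [h.1] : s - σ < 0), abs_of_nonpos h.2,
      abs_of_nonpos (by linarith)]
    ring

lemma mem_Icc_of_mem_uIoc_zero {r s σ : ℝ} (hs : s ∈ Icc (-r) r) (h : σ ∈ uIoc 0 s) :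
    σ ∈ Icc (-r) r := by
  rcases mem_uIoc.1 h with h | h
  · exact ⟨by linarith [hs.1, hs.2], by linarith [hs.2]⟩
  · exact ⟨by linarith [hs.1], by linarith [hs.1, hs.2]⟩

/-- Each application of `duhamel f` gains two integrations in `|x|` with no loss in the constant:
the weight `exp (L |x|)` absorbs the quotients `f x / f s` and `f σ / f s`. -/
lemma norm_duhamel_le {f g : ℝ → ℂ} {r L B : ℝ} {k : ℕ}
    (hL : ∀ x ∈ Icc (-r) r, ∀ s ∈ Icc (-r) r, ‖f s‖ ≤ ‖f x‖ * Real.exp (L * |x - s|))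
    (hf0 : ∀ x ∈ Icc (-r) r, f x ≠ 0)
    (hg : ∀ x ∈ Icc (-r) r, ‖g x‖ ≤ B * |x| ^ k * Real.exp (L * |x|))
    {x : ℝ} (hx : x ∈ Icc (-r) r) :
    ‖duhamel f g x‖ ≤ B / ((k + 1) * (k + 2)) * |x| ^ (k + 2) * Real.exp (L * |x|) := by
  have hin : ∀ s ∈ Icc (-r) r, ‖∫ σ in (0 : ℝ)..s, f σ * g σ‖ ≤
      (‖f s‖ * Real.exp (L * |s|) * B) * |s| ^ (k + 1) / (k + 1) := fun s hs => by
    refine norm_integral_zero_le_of_norm_le_pow fun σ hσ => ?_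
    have hσ' := mem_Icc_of_mem_uIoc_zero hs hσ
    rw [norm_mul]
    refine (mul_le_mul (hL s hs σ hσ') (hg σ hσ') (norm_nonneg _) (by positivity)).trans_eq ?_
    rw [abs_sub_of_mem_uIoc_zero hσ, show L * |s| = L * (|s| - |σ|) + L * |σ| by ring,
      Real.exp_add]
    ring
  unfold duhamel
  -- The factor `f x` has to be inside the integral for the quotient `f x / f s` to be used.
  rw [← intervalIntegral.integral_const_mul]
  refine (norm_integral_zero_le_of_norm_le_pow (B := Real.exp (L * |x|) * B / (k + 1))
    (k := k + 1) fun s hs => ?_).trans_eq ?_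
  · have hs' := mem_Icc_of_mem_uIoc_zero hx hs
    have hpos : 0 < ‖f s‖ := norm_pos_iff.2 (hf0 s hs')
    have h1 := hL s hs' x hx
    rw [abs_sub_comm, abs_sub_of_mem_uIoc_zero hs] at h1
    rw [norm_mul, norm_mul, norm_inv, norm_pow]
    calc ‖f x‖ * ((‖f s‖ ^ 2)⁻¹ * ‖∫ σ in (0 : ℝ)..s, f σ * g σ‖)
        ≤ (‖f s‖ * Real.exp (L * (|x| - |s|))) * ((‖f s‖ ^ 2)⁻¹ *
          ((‖f s‖ * Real.exp (L * |s|) * B) * |s| ^ (k + 1) / (k + 1))) := by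
          gcongr
          exact hin s hs'
      _ = Real.exp (L * |x|) * B / (k + 1) * |s| ^ (k + 1) := by
          rw [show L * |x| = L * (|x| - |s|) + L * |s| by ring, Real.exp_add]
          field_simp
  · push_cast
    field_simp
    ring

lemma norm_iterate_duhamel_le {f g : ℝ → ℂ} {r L B : ℝ} (hB : 0 ≤ B)
    (hL : ∀ x ∈ Icc (-r) r, ∀ s ∈ Icc (-r) r, ‖f s‖ ≤ ‖f x‖ * Real.exp (L * |x - s|))
    (hf0 : ∀ x ∈ Icc (-r) r, f x ≠ 0)
    (hL0 : 0 ≤ L) (hg : ∀ x ∈ Icc (-r) r, ‖g x‖ ≤ B) (n : ℕ) {x : ℝ} (hx : x ∈ Icc (-r) r) :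
    ‖(duhamel f)^[n] g x‖ ≤ B / (2 * n).factorial * |x| ^ (2 * n) * Real.exp (L * |x|) := by
  induction n generalizing x with
  | zero =>
    simpa using (hg x hx).trans (le_mul_of_one_le_right hB (Real.one_le_exp (by positivity)))
  | succ n ih =>
    rw [Function.iterate_succ_apply']
    refine (norm_duhamel_le hL hf0 (fun y hy => ih hy) hx).trans_eq ?_
    rw [show 2 * (n + 1) = 2 * n + 1 + 1 by ring, Nat.factorial_succ, Nat.factorial_succ]
    push_cast
    field_simp
    ring

/-! ### Polynomial moments in time -/

/-- The moment of `v` against the polynomial `P`, over the interval `[a, a + ℓ]` rescaled to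
`[0, 1]`. -/
noncomputable def moment (a ℓ : ℝ) (P : Polynomial ℂ) (v : ℝ → ℂ) : ℂ :=
  ∫ s in (0 : ℝ)..1, v (a + ℓ * s) * P.eval (s : ℂ)

section Moment

variable {a ℓ : ℝ} {P : Polynomial ℂ}

lemma mapsTo_affine_unitInterval (hℓ : 0 ≤ ℓ) :
    MapsTo (fun s : ℝ => a + ℓ * s) (Icc 0 1) (Icc a (a + ℓ)) := fun s hs =>
  ⟨by nlinarith [hs.1], by nlinarith [hs.2]⟩

lemma continuous_eval_ofReal (P : Polynomial ℂ) : Continuous fun s : ℝ => P.eval (s : ℂ) :=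
  P.continuous.comp Complex.continuous_ofReal

lemma ContinuousOn.moment_integrable {v : ℝ → ℂ} (hℓ : 0 ≤ ℓ)
    (hv : ContinuousOn v (Icc a (a + ℓ))) :
    IntervalIntegrable (fun s => v (a + ℓ * s) * P.eval (s : ℂ)) MeasureTheory.volume 0 1 := by
  refine ContinuousOn.intervalIntegrable ?_
  rw [uIcc_of_le zero_le_one]
  exact (hv.comp (by fun_prop) (mapsTo_affine_unitInterval hℓ)).mul
    (continuous_eval_ofReal P).continuousOn

lemma moment_congr (hℓ : 0 ≤ ℓ) {v w : ℝ → ℂ} (h : EqOn v w (Icc a (a + ℓ))) :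
    moment a ℓ P v = moment a ℓ P w := by
  refine intervalIntegral.integral_congr fun s hs => ?_
  rw [uIcc_of_le zero_le_one] at hs
  rw [h (mapsTo_affine_unitInterval hℓ hs)]

lemma moment_const_mul (c : ℂ) (v : ℝ → ℂ) :
    moment a ℓ P (fun t => c * v t) = c * moment a ℓ P v := by
  simp only [moment, mul_assoc, intervalIntegral.integral_const_mul]

lemma moment_add (hℓ : 0 ≤ ℓ) {v w : ℝ → ℂ} (hv : ContinuousOn v (Icc a (a + ℓ)))
    (hw : ContinuousOn w (Icc a (a + ℓ))) :
    moment a ℓ P (fun t => v t + w t) = moment a ℓ P v + moment a ℓ P w := by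
  simp only [moment, add_mul]
  exact intervalIntegral.integral_add (hv.moment_integrable hℓ) (hw.moment_integrable hℓ)

lemma moment_finset_sum (hℓ : 0 ≤ ℓ) {v : ℕ → ℝ → ℂ} (I : Finset ℕ)
    (hv : ∀ i, ContinuousOn (v i) (Icc a (a + ℓ))) :
    moment a ℓ P (fun t => ∑ i ∈ I, v i t) = ∑ i ∈ I, moment a ℓ P (v i) := by
  simp only [moment, Finset.sum_mul]
  exact intervalIntegral.integral_finsetSum fun i _ => (hv i).moment_integrable hℓ

lemma norm_moment_le (hℓ : 0 ≤ ℓ) {v : ℝ → ℂ} {M D : ℝ} (hM : ∀ t ∈ Icc a (a + ℓ), ‖v t‖ ≤ M)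
    (hP : ∀ s ∈ Icc (0 : ℝ) 1, ‖P.eval (s : ℂ)‖ ≤ D) : ‖moment a ℓ P v‖ ≤ M * D := by
  have hM0 : 0 ≤ M := (norm_nonneg _).trans (hM a ⟨le_rfl, by linarith⟩)
  have := intervalIntegral.norm_integral_le_of_norm_le_const (a := 0) (b := 1) (C := M * D)
    (f := fun s : ℝ => v (a + ℓ * s) * P.eval (s : ℂ)) fun s hs => by
      rw [uIoc_of_le zero_le_one] at hs
      have hs' := Ioc_subset_Icc_self hs
      rw [norm_mul]
      exact mul_le_mul (hM _ (mapsTo_affine_unitInterval hℓ hs')) (hP s hs') (norm_nonneg _) hM0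
  simpa [moment] using this

/-- Integration by parts against a polynomial vanishing at both ends of the interval. -/
lemma moment_deriv (hℓ : 0 ≤ ℓ) {v v' : ℝ → ℂ} (hv : ∀ t ∈ Icc a (a + ℓ), HasDerivAt v (v' t) t)
    (hv' : ContinuousOn v' (Icc a (a + ℓ))) (h0 : P.eval 0 = 0) (h1 : P.eval 1 = 0) :
    (ℓ : ℂ) * moment a ℓ P v' = -moment a ℓ P.derivative v := by
  have hu : ∀ s ∈ uIcc (0 : ℝ) 1,
      HasDerivAt (fun s : ℝ => v (a + ℓ * s)) (ℓ • v' (a + ℓ * s)) s := fun s hs => by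
    rw [uIcc_of_le zero_le_one] at hs
    have h1 : HasDerivAt (fun s : ℝ => a + ℓ * s) ℓ s := by
      simpa using ((hasDerivAt_id s).const_mul ℓ).const_add a
    exact (hv _ (mapsTo_affine_unitInterval hℓ hs)).scomp s h1
  have hp : ∀ s ∈ uIcc (0 : ℝ) 1,
      HasDerivAt (fun s : ℝ => P.eval (s : ℂ)) (P.derivative.eval (s : ℂ)) s := fun s _ =>
    (P.hasDerivAt (s : ℂ)).comp_ofReal
  have hi : IntervalIntegrable (fun s : ℝ => ℓ • v' (a + ℓ * s))
      MeasureTheory.volume 0 1 := by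
    refine ContinuousOn.intervalIntegrable ?_
    rw [uIcc_of_le zero_le_one]
    exact (continuousOn_const (c := ℓ)).smul
      (hv'.comp (by fun_prop) (mapsTo_affine_unitInterval hℓ))
  have := intervalIntegral.integral_mul_deriv_eq_deriv_mul hu hp hi
    ((continuous_eval_ofReal P.derivative).intervalIntegrable 0 1)
  simp only [Complex.ofReal_one, Complex.ofReal_zero, h0, h1, mul_zero, sub_zero, zero_sub,
    Complex.real_smul, mul_assoc, intervalIntegral.integral_const_mul] at this
  rw [moment, moment, this, neg_neg]

section Parametric

variable {b : ℝ} {K : ℝ → ℝ → ℂ}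

lemma continuousOn_moment (hℓ : 0 ≤ ℓ)
    (hK : ContinuousOn (fun p : ℝ × ℝ => K p.1 p.2) (Ioo (-b) b ×ˢ Icc a (a + ℓ))) :
    ContinuousOn (fun x => moment a ℓ P (K x)) (Ioo (-b) b) := by
  -- Restricting `x` to the open interval and clamping `s` to `[0, 1]` makes the integrand
  -- continuous everywhere.
  rw [continuousOn_iff_continuous_domRestrict]
  have : (Ioo (-b) b).domRestrict (fun x => moment a ℓ P (K x)) = fun x : Ioo (-b) b =>
      ∫ s in (0 : ℝ)..1, K x (a + ℓ * projIcc 0 1 zero_le_one s) * P.eval (s : ℂ) := by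
    ext x
    refine intervalIntegral.integral_congr fun s hs => ?_
    rw [uIcc_of_le zero_le_one] at hs
    rw [projIcc_of_mem _ hs]
  rw [this]
  refine intervalIntegral.continuous_parametric_intervalIntegral_of_continuous'
    (f := fun (x : Ioo (-b) b) s => K x (a + ℓ * projIcc 0 1 zero_le_one s) * P.eval (s : ℂ))
    (Continuous.mul ?_ ((continuous_eval_ofReal P).comp continuous_snd)) 0 1
  refine hK.comp_continuous (f := fun p : Ioo (-b) b × ℝ =>
    ((p.1 : ℝ), a + ℓ * (projIcc 0 1 zero_le_one p.2 : ℝ))) ?_ fun p => ?_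
  · have : Continuous (projIcc (0 : ℝ) 1 zero_le_one) := continuous_projIcc
    fun_prop
  · exact ⟨p.1.2, mapsTo_affine_unitInterval hℓ (projIcc 0 1 zero_le_one p.2).2⟩

lemma moment_integral (hℓ : 0 ≤ ℓ)
    (hK : ContinuousOn (fun p : ℝ × ℝ => K p.1 p.2) (Ioo (-b) b ×ˢ Icc a (a + ℓ)))
    {x : ℝ} (hx : x ∈ Ioo (-b) b) :
    moment a ℓ P (fun t => ∫ σ in (0 : ℝ)..x, K σ t) =
      ∫ σ in (0 : ℝ)..x, moment a ℓ P (K σ) := by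
  unfold moment
  simp only [← intervalIntegral.integral_mul_const]
  refine MeasureTheory.intervalIntegral_intervalIntegral_swap
    (F := fun s σ => K σ (a + ℓ * s) * P.eval (s : ℂ)) ?_
  refine MeasureTheory.IntegrableOn.mono_set (t := uIcc 0 1 ×ˢ uIcc 0 x) ?_
    (prod_mono uIoc_subset_uIcc uIoc_subset_uIcc)
  refine ContinuousOn.integrableOn_compact (isCompact_uIcc.prod isCompact_uIcc) ?_
  refine ContinuousOn.mul (hK.comp (f := fun p : ℝ × ℝ => (p.2, a + ℓ * p.1)) (by fun_prop) ?_)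
    ((continuous_eval_ofReal P).comp continuous_fst).continuousOn
  rintro ⟨s, σ⟩ ⟨hs, hσ⟩
  rw [uIcc_of_le zero_le_one] at hs
  exact ⟨uIcc_zero_subset_Ioo hx hσ, mapsTo_affine_unitInterval hℓ hs⟩

end Parametric

end Moment

/-! ### The weight -/

/-- The weight `(s (1 - s)) ^ N`; it vanishes to order `N` at `0` and `1`, and concentrates at
`1/2` as `N → ∞`. -/
noncomputable def bumpPoly (N : ℕ) : Polynomial ℂ :=
  (Polynomial.X * (1 - Polynomial.X)) ^ N

lemma eval_bumpPoly (N : ℕ) (s : ℝ) :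
    (bumpPoly N).eval (s : ℂ) = (((s * (1 - s)) ^ N : ℝ) : ℂ) := by
  simp [bumpPoly]

lemma eval_iterate_derivative_bumpPoly {N i : ℕ} (hi : i < N) :
    (Polynomial.derivative^[i] (bumpPoly N)).eval 0 = 0 ∧
      (Polynomial.derivative^[i] (bumpPoly N)).eval 1 = 0 := by
  obtain ⟨R, hR⟩ := Polynomial.pow_sub_dvd_iterate_derivative_pow
    (Polynomial.X * (1 - Polynomial.X) : Polynomial ℂ) N i
  have : N - i ≠ 0 := by omega
  simp [bumpPoly, hR, this]

/-- Rodrigues' formula bounds the `N`-th derivative of the weight: up to the factor `N!` it is the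
shifted Legendre polynomial, whose coefficients are products of two binomial coefficients. -/
lemma norm_eval_iterate_derivative_bumpPoly_le (N : ℕ) {s : ℝ} (hs : s ∈ Icc (0 : ℝ) 1) :
    ‖(Polynomial.derivative^[N] (bumpPoly N)).eval (s : ℂ)‖ ≤ N.factorial * 8 ^ N := by
  have h : Polynomial.derivative^[N] (bumpPoly N) =
      ((N.factorial : Polynomial ℤ) * Polynomial.shiftedLegendre N).map (Int.castRingHom ℂ) := by
    rw [Polynomial.factorial_mul_shiftedLegendre_eq, ← Polynomial.iterate_derivative_map]
    simp [bumpPoly, mul_pow]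
  rw [h]
  simp only [Polynomial.shiftedLegendre, Polynomial.map_mul, Polynomial.eval_mul,
    Polynomial.map_natCast, Polynomial.eval_natCast, Polynomial.map_sum, Polynomial.eval_finsetSum,
    norm_mul, Complex.norm_natCast]
  refine mul_le_mul_of_nonneg_left ((norm_sum_le _ _).trans ?_) (by positivity)
  calc _ ≤ ∑ k ∈ Finset.range (N + 1), (N.choose k : ℝ) * 4 ^ N := by
        refine Finset.sum_le_sum fun k hk => ?_
        have hk' : k ≤ N := by simpa [Nat.lt_succ_iff] using hk
        have h4 : ((N + k).choose N : ℝ) ≤ 4 ^ N := by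
          have : (N + k).choose N ≤ 2 ^ (N + k) := Nat.choose_le_two_pow _ _
          have h2 : 2 ^ (N + k) ≤ 2 ^ (2 * N) := Nat.pow_le_pow_right (by norm_num) (by omega)
          rw [pow_mul] at h2
          exact_mod_cast this.trans h2
        have h5 : |s| ^ k ≤ 1 := pow_le_one₀ (abs_nonneg _) (abs_le.2 ⟨by linarith [hs.1], hs.2⟩)
        simp only [Polynomial.map_C, Polynomial.map_pow, Polynomial.map_X,
          Polynomial.eval_C, Polynomial.eval_pow, Polynomial.eval_X]
        simp only [map_mul, map_pow, map_neg, map_one, map_natCast, norm_mul, norm_pow, norm_neg,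
          norm_one, one_pow, one_mul, Complex.norm_natCast, Complex.norm_real, Real.norm_eq_abs]
        calc (N.choose k : ℝ) * ((N + k).choose N) * |s| ^ k
            ≤ (N.choose k : ℝ) * 4 ^ N * 1 := by gcongr
          _ = _ := mul_one _
    _ = 8 ^ N := by
        rw [← Finset.sum_mul, ← Nat.cast_sum, Nat.sum_range_choose, Nat.cast_pow, ← mul_pow]
        norm_num

/-- On `[1/4, 3/4]` the weight is at least `(3/16) ^ N`. -/
lemma le_integral_bump (N : ℕ) :
    (3 / 16 : ℝ) ^ N / 2 ≤ ∫ s in (0 : ℝ)..1, (s * (1 - s)) ^ N := by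
  have hc : Continuous fun s : ℝ => (s * (1 - s)) ^ N := by fun_prop
  calc (3 / 16 : ℝ) ^ N / 2 = ∫ _ in (1 / 4 : ℝ)..3 / 4, (3 / 16 : ℝ) ^ N := by
        rw [intervalIntegral.integral_const]; norm_num; ring
    _ ≤ ∫ s in (1 / 4 : ℝ)..3 / 4, (s * (1 - s)) ^ N := by
        refine intervalIntegral.integral_mono_on (by norm_num) (by simp)
          (hc.intervalIntegrable _ _) fun s hs => ?_
        exact pow_le_pow_left₀ (by norm_num) (by nlinarith [hs.1, hs.2]) N
    _ ≤ ∫ s in (0 : ℝ)..1, (s * (1 - s)) ^ N := by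
        refine intervalIntegral.integral_mono_interval (by norm_num) (by norm_num) (by norm_num)
          ?_ (hc.intervalIntegrable _ _)
        refine (MeasureTheory.ae_restrict_iff' measurableSet_Ioc).2 (Eventually.of_forall ?_)
        exact fun s hs => pow_nonneg (mul_nonneg hs.1.le (by linarith [hs.2])) N

lemma norm_moment_bumpPoly_le {a ℓ : ℝ} (hℓ : 0 ≤ ℓ) {v : ℝ → ℂ} {M : ℝ}
    (hM : ∀ t ∈ Icc a (a + ℓ), ‖v t‖ ≤ M) (N : ℕ) :
    ‖moment a ℓ (bumpPoly N) v‖ ≤ M * ∫ s in (0 : ℝ)..1, (s * (1 - s)) ^ N := by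
  have hc : Continuous fun s : ℝ => M * (s * (1 - s)) ^ N := by fun_prop
  rw [← intervalIntegral.integral_const_mul]
  refine intervalIntegral.norm_integral_le_of_norm_le zero_le_one (Eventually.of_forall ?_)
    (hc.intervalIntegrable _ _)
  intro s hs
  rw [eval_bumpPoly, norm_mul, Complex.norm_real, Real.norm_of_nonneg
    (pow_nonneg (mul_nonneg hs.1.le (by linarith [hs.2])) N)]
  exact mul_le_mul_of_nonneg_right (hM _ (mapsTo_affine_unitInterval hℓ (Ioc_subset_Icc_self hs)))
    (pow_nonneg (mul_nonneg hs.1.le (by linarith [hs.2])) N)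

lemma tendsto_moment_bumpPoly {a ℓ : ℝ} (hℓ : 0 ≤ ℓ) {v : ℝ → ℂ}
    (hv : ContinuousOn v (Icc a (a + ℓ))) :
    Tendsto (fun N : ℕ => (∫ s in (0 : ℝ)..1, (s * (1 - s)) ^ N)⁻¹ • moment a ℓ (bumpPoly N) v)
      atTop (𝓝 (v (a + ℓ * (1 / 2)))) := by
  have h := tendsto_setIntegral_pow_smul_of_unique_maximum_of_isCompact_of_continuousOn
    (μ := MeasureTheory.volume) (s := Icc (0 : ℝ) 1) (c := fun s => s * (1 - s)) (x₀ := 1 / 2)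
    (g := fun s => v (a + ℓ * s)) isCompact_Icc (by fun_prop)
    (fun y _ hy => by
      have : 0 < (y - 1 / 2) ^ 2 := by
        have := sub_ne_zero.2 hy
        positivity
      nlinarith)
    (fun y hy => mul_nonneg hy.1 (by linarith [hy.2])) (by norm_num)
    (by rw [interior_Icc, closure_Ioo (by norm_num)]; constructor <;> norm_num)
    (hv.comp (by fun_prop) (mapsTo_affine_unitInterval hℓ))
  refine h.congr fun N => ?_
  rw [moment, intervalIntegral.integral_of_le zero_le_one, intervalIntegral.integral_of_le
    zero_le_one, MeasureTheory.integral_Icc_eq_integral_Ioc,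
    MeasureTheory.integral_Icc_eq_integral_Ioc]
  simp only [eval_bumpPoly, Complex.real_smul, mul_comm]

/-! ### The moments of a solution -/

namespace IsNonvanishingSolution

variable {q f : ℝ → ℂ} {b : ℝ} {α : ℂ}

lemma continuousOn (hf : IsNonvanishingSolution q b α f) : ContinuousOn f (Ioo (-b) b) :=
  fun x hx => (hf.differentiable x hx).continuousAt.continuousWithinAt

lemma continuousOn_deriv (hf : IsNonvanishingSolution q b α f) :
    ContinuousOn (deriv f) (Ioo (-b) b) :=
  fun x hx => (hf.equation x hx).continuousAt.continuousWithinAt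

end IsNonvanishingSolution

section Solution

variable {q f : ℝ → ℂ} {b τ : ℝ} {α : ℂ} {u : ℝ → ℝ → ℂ}

lemma continuousOn_slice {K : ℝ → ℝ → ℂ} {I J : Set ℝ}
    (hK : ContinuousOn (fun p : ℝ × ℝ => K p.1 p.2) (I ×ˢ J)) {t : ℝ} (ht : t ∈ J) :
    ContinuousOn (fun x => K x t) I :=
  hK.comp (f := fun x : ℝ => (x, t)) (by fun_prop) fun _ hx => ⟨hx, ht⟩

lemma continuousOn_slice_right {K : ℝ → ℝ → ℂ} {I J : Set ℝ}
    (hK : ContinuousOn (fun p : ℝ × ℝ => K p.1 p.2) (I ×ˢ J)) {x : ℝ} (hx : x ∈ I) :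
    ContinuousOn (fun t => K x t) J :=
  hK.comp (f := fun t : ℝ => (x, t)) (by fun_prop) fun _ ht => ⟨hx, ht⟩

/-- The Wronskian of `f` and `u(·, t)`. -/
noncomputable def wronskian (f : ℝ → ℂ) (u : ℝ → ℝ → ℂ) (x t : ℝ) : ℂ :=
  f x * deriv (fun y => u y t) x - deriv f x * u x t

lemma continuousOn_wronskian (hf : IsNonvanishingSolution q b α f)
    (hu : IsClassicalSolution q b τ u) :
    ContinuousOn (fun p : ℝ × ℝ => wronskian f u p.1 p.2) (Ioo (-b) b ×ˢ Ioo (-τ) τ) := by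
  have h1 : MapsTo (Prod.fst : ℝ × ℝ → ℝ) (Ioo (-b) b ×ˢ Ioo (-τ) τ) (Ioo (-b) b) :=
    fun p hp => hp.1
  exact ((hf.continuousOn.comp continuousOn_fst h1).mul hu.continuousOn_x).sub
    ((hf.continuousOn_deriv.comp continuousOn_fst h1).mul hu.continuousOn)

lemma continuousOn_mul_deriv_time (hf : IsNonvanishingSolution q b α f)
    (hu : IsClassicalSolution q b τ u) :
    ContinuousOn (fun p : ℝ × ℝ => f p.1 * deriv (fun s => u p.1 s) p.2)
      (Ioo (-b) b ×ˢ Ioo (-τ) τ) :=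
  (hf.continuousOn.comp continuousOn_fst fun _ hp => hp.1).mul hu.continuousOn_t

/-- The equation for `u` turns into `W_x = f u_t` for the Wronskian `W`. -/
lemma wronskian_eq (hf : IsNonvanishingSolution q b α f) (hu : IsClassicalSolution q b τ u)
    {x t : ℝ} (hx : x ∈ Ioo (-b) b) (ht : t ∈ Ioo (-τ) τ) :
    wronskian f u x t = (deriv (fun y => u y t) 0 - α * u 0 t) +
      ∫ σ in (0 : ℝ)..x, f σ * deriv (fun s => u σ s) t := by
  have hd : ∀ y ∈ uIcc 0 x, HasDerivAt (fun y => wronskian f u y t)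
      (f y * deriv (fun s => u y s) t) y := fun y hy => by
    have hy' := uIcc_zero_subset_Ioo hx hy
    have h : HasDerivAt (fun y => wronskian f u y t) _ y :=
      ((hf.differentiable y hy').hasDerivAt.mul
      (hu.differentiable_xx y hy' t ht).hasDerivAt).sub
      ((hf.equation y hy').mul (hu.differentiable_x y hy' t ht).hasDerivAt)
    rw [← hu.equation y hy' t ht]
    refine h.congr_deriv ?_
    ring
  rw [intervalIntegral.integral_eq_sub_of_hasDerivAt hd
    ((continuousOn_slice (K := fun x t => f x * deriv (fun s => u x s) t)
      (continuousOn_mul_deriv_time hf hu) ht).intervalIntegrable_zero_of_mem_Ioo hx)]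
  simp only [wronskian, hf.value_zero, hf.deriv_zero]
  ring

/-- Reduction of order: `(u / f)_x = W / f ^ 2` for the Wronskian `W`. -/
lemma eq_mul_add_integral_wronskian (hf : IsNonvanishingSolution q b α f)
    (hu : IsClassicalSolution q b τ u)
    {x t : ℝ} (hx : x ∈ Ioo (-b) b) (ht : t ∈ Ioo (-τ) τ) :
    u x t = f x * (u 0 t + ∫ s in (0 : ℝ)..x, (f s ^ 2)⁻¹ * wronskian f u s t) := by
  have hd : ∀ y ∈ uIcc 0 x, HasDerivAt (fun y => u y t / f y)
      ((f y ^ 2)⁻¹ * wronskian f u y t) y := fun y hy => by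
    have hy' := uIcc_zero_subset_Ioo hx hy
    have h : HasDerivAt (fun y => u y t / f y) _ y :=
      (hu.differentiable_x y hy' t ht).hasDerivAt.div
      (hf.differentiable y hy').hasDerivAt (hf.ne_zero y hy')
    refine h.congr_deriv ?_
    unfold wronskian
    ring
  have hc : ContinuousOn (fun y => (f y ^ 2)⁻¹ * wronskian f u y t) (Ioo (-b) b) :=
    ((hf.continuousOn.pow 2).inv₀ fun y hy => pow_ne_zero 2 (hf.ne_zero y hy)).mul
      (continuousOn_slice (continuousOn_wronskian hf hu) ht)
  rw [intervalIntegral.integral_eq_sub_of_hasDerivAt hd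
    (hc.intervalIntegrable_zero_of_mem_Ioo hx), hf.value_zero]
  have := hf.ne_zero x hx
  field_simp
  ring

variable {a ℓ : ℝ} {P : Polynomial ℂ} {F G : ℝ → ℂ}

/-- Variation of constants for a time moment of `u`. -/
lemma moment_eq_duhamel (hℓ : 0 ≤ ℓ) (hJ : Icc a (a + ℓ) ⊆ Ioo (-τ) τ)
    (hf : IsNonvanishingSolution q b α f) (hu : IsClassicalSolution q b τ u)
    (hu0 : ∀ t ∈ Ioo (-τ) τ, u 0 t = F t)
    (hux0 : ∀ t ∈ Ioo (-τ) τ, deriv (fun x => u x t) 0 = G t)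
    {x : ℝ} (hx : x ∈ Ioo (-b) b) :
    moment a ℓ P (u x) = moment a ℓ P F * cosSol f α x + moment a ℓ P G * sinSol f x +
      duhamel f (fun y => moment a ℓ P (deriv (u y))) x := by
  have h0 : (0 : ℝ) ∈ Ioo (-b) b := ⟨by linarith [hx.1, hx.2], by linarith [hx.1, hx.2]⟩
  have hmono : Ioo (-b) b ×ˢ Icc a (a + ℓ) ⊆ Ioo (-b) b ×ˢ Ioo (-τ) τ := prod_mono_right hJ
  have hF : ContinuousOn F (Icc a (a + ℓ)) :=
    ((continuousOn_slice_right hu.continuousOn h0).mono hJ).congr fun t ht => (hu0 t (hJ ht)).symm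
  have hG : ContinuousOn G (Icc a (a + ℓ)) :=
    ((continuousOn_slice_right (K := fun x t => deriv (fun y => u y t) x)
      hu.continuousOn_x h0).mono hJ).congr fun t ht => (hux0 t (hJ ht)).symm
  have hinv : ContinuousOn (fun y => (f y ^ 2)⁻¹) (Ioo (-b) b) :=
    (hf.continuousOn.pow 2).inv₀ fun y hy => pow_ne_zero 2 (hf.ne_zero y hy)
  have hft := (continuousOn_mul_deriv_time hf hu).mono hmono
  have hW : ∀ y ∈ Ioo (-b) b, moment a ℓ P (wronskian f u y) =
      moment a ℓ P G - α * moment a ℓ P F +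
        ∫ σ in (0 : ℝ)..y, f σ * moment a ℓ P (deriv (u σ)) := fun y hy => by
    -- Continuity in `t` of the integral is read off from the identity it occurs in.
    have hI : ContinuousOn (fun t => ∫ σ in (0 : ℝ)..y, f σ * deriv (u σ) t) (Icc a (a + ℓ)) := by
      refine (((continuousOn_slice_right (continuousOn_wronskian hf hu) hy).mono hJ).sub
        (hG.sub ((continuousOn_const (c := α)).mul hF))).congr fun t ht => ?_
      have := wronskian_eq hf hu hy (hJ ht)
      rw [hu0 t (hJ ht), hux0 t (hJ ht)] at this
      exact eq_sub_of_add_eq' this.symm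
    have e : EqOn (wronskian f u y) (fun t => (G t + (-α) * F t) +
        ∫ σ in (0 : ℝ)..y, f σ * deriv (u σ) t) (Icc a (a + ℓ)) := fun t ht => by
      beta_reduce
      rw [wronskian_eq hf hu hy (hJ ht), hu0 t (hJ ht), hux0 t (hJ ht)]
      ring
    have hαF : ContinuousOn (fun t => (-α) * F t) (Icc a (a + ℓ)) := continuousOn_const.mul hF
    rw [moment_congr hℓ e, moment_add (v := fun t => G t + (-α) * F t) hℓ (hG.add hαF) hI,
      moment_add hℓ hG hαF, moment_const_mul,
      moment_integral (K := fun σ t => f σ * deriv (u σ) t) hℓ hft hy]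
    simp only [moment_const_mul]
    ring
  have hWi : ContinuousOn (fun p : ℝ × ℝ => (f p.1 ^ 2)⁻¹ * wronskian f u p.1 p.2)
      (Ioo (-b) b ×ˢ Icc a (a + ℓ)) :=
    (hinv.comp continuousOn_fst fun _ hp => hp.1).mul ((continuousOn_wronskian hf hu).mono hmono)
  have hU : moment a ℓ P (u x) = f x * (moment a ℓ P F +
      ∫ s in (0 : ℝ)..x, (f s ^ 2)⁻¹ * moment a ℓ P (wronskian f u s)) := by
    have hI : ContinuousOn (fun t => ∫ s in (0 : ℝ)..x, (f s ^ 2)⁻¹ * wronskian f u s t)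
        (Icc a (a + ℓ)) := by
      refine ((((continuousOn_slice_right hu.continuousOn hx).mono hJ).div_const (f x)).sub
        hF).congr fun t ht => ?_
      have := eq_mul_add_integral_wronskian hf hu hx (hJ ht)
      rw [hu0 t (hJ ht)] at this
      refine eq_sub_of_add_eq' ?_
      beta_reduce
      rw [this]
      exact (mul_div_cancel_left₀ _ (hf.ne_zero x hx)).symm
    have e : EqOn (u x) (fun t => f x * (F t +
        ∫ s in (0 : ℝ)..x, (f s ^ 2)⁻¹ * wronskian f u s t)) (Icc a (a + ℓ)) := fun t ht => by
      beta_reduce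
      rw [eq_mul_add_integral_wronskian hf hu hx (hJ ht), hu0 t (hJ ht)]
    rw [moment_congr hℓ e, moment_const_mul, moment_add hℓ hF hI,
      moment_integral (K := fun s t => (f s ^ 2)⁻¹ * wronskian f u s t) hℓ hWi hx]
    simp only [moment_const_mul]
  have hut : ContinuousOn (fun y => moment a ℓ P (deriv (u y))) (Ioo (-b) b) :=
    continuousOn_moment (K := fun y t => deriv (u y) t) hℓ (hu.continuousOn_t.mono hmono)
  have hs : ∫ s in (0 : ℝ)..x, (f s ^ 2)⁻¹ * moment a ℓ P (wronskian f u s) =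
      (∫ s in (0 : ℝ)..x, (f s ^ 2)⁻¹) * (moment a ℓ P G - α * moment a ℓ P F) +
      ∫ s in (0 : ℝ)..x, (f s ^ 2)⁻¹ * ∫ σ in (0 : ℝ)..s, f σ * moment a ℓ P (deriv (u σ)) := by
    rw [← intervalIntegral.integral_mul_const, ← intervalIntegral.integral_add
      (f := fun s => (f s ^ 2)⁻¹ * (moment a ℓ P G - α * moment a ℓ P F))
      ((hinv.mul continuousOn_const).intervalIntegrable_zero_of_mem_Ioo hx)
      ((continuousOn_inv_sq_mul_integral hf.continuousOn hf.ne_zero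
        hut).intervalIntegrable_zero_of_mem_Ioo hx)]
    refine intervalIntegral.integral_congr fun s hs => ?_
    rw [hW s (uIcc_zero_subset_Ioo hx hs)]
    ring
  rw [hU, hs]
  simp only [cosSol, sinSol, formalPower_zero, formalPower_one, duhamel]
  ring

end Solution

/-! ### Averaged Taylor expansion in time -/

section HolmgrenData

variable {a ℓ : ℝ} {J : Set ℝ} {F : ℝ → ℂ}

lemma ContDiffOn.hasDerivAt_iteratedDeriv (hJ : IsOpen J) (hF : ContDiffOn ℝ ∞ F J) (i : ℕ)
    {t : ℝ} (ht : t ∈ J) : HasDerivAt (iteratedDeriv i F) (iteratedDeriv (i + 1) F t) t := by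
  have h : DifferentiableOn ℝ (iteratedDeriv i F) J :=
    (hF.differentiableOn_iteratedDerivWithin (m := i) (by exact_mod_cast ENat.natCast_lt_top i)
      hJ.uniqueDiffOn).congr fun y hy => (iteratedDerivWithin_of_isOpen hJ hy).symm
  rw [iteratedDeriv_succ]
  exact (h.differentiableAt (hJ.mem_nhds ht)).hasDerivAt

lemma ContDiffOn.continuousOn_iteratedDeriv_of_isOpen (hJ : IsOpen J) (hF : ContDiffOn ℝ ∞ F J)
    (i : ℕ) : ContinuousOn (iteratedDeriv i F) J :=
  fun _ ht => (hF.hasDerivAt_iteratedDeriv hJ i ht).continuousAt.continuousWithinAt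

/-- As long as fewer than `N` derivatives fall on the weight, integration by parts has no boundary
terms. -/
lemma moment_deriv_bumpPoly (hℓ : 0 < ℓ) {N i : ℕ} (hi : i < N) {v v' : ℝ → ℂ}
    (hv : ∀ t ∈ Icc a (a + ℓ), HasDerivAt v (v' t) t) (hv' : ContinuousOn v' (Icc a (a + ℓ))) :
    moment a ℓ (Polynomial.derivative^[i] (bumpPoly N)) v' =
      (-(ℓ : ℂ)⁻¹) * moment a ℓ (Polynomial.derivative^[i + 1] (bumpPoly N)) v := by
  have h := moment_deriv hℓ.le hv hv' (eval_iterate_derivative_bumpPoly hi).1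
    (eval_iterate_derivative_bumpPoly hi).2
  have h0 : (ℓ : ℂ) ≠ 0 := by exact_mod_cast hℓ.ne'
  rw [Function.iterate_succ_apply']
  field_simp
  rw [mul_comm]
  exact h

lemma moment_iteratedDeriv (hℓ : 0 < ℓ) (hJ : IsOpen J) (hsub : Icc a (a + ℓ) ⊆ J)
    (hF : ContDiffOn ℝ ∞ F J) {N k : ℕ} (hk : k ≤ N) (i : ℕ) :
    moment a ℓ (bumpPoly N) (iteratedDeriv (i + k) F) =
      (-(ℓ : ℂ)⁻¹) ^ k *
        moment a ℓ (Polynomial.derivative^[k] (bumpPoly N)) (iteratedDeriv i F) := by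
  induction k generalizing i with
  | zero => simp
  | succ k ih =>
    rw [show i + (k + 1) = i + 1 + k by ring, ih (by omega), moment_deriv_bumpPoly hℓ (by omega)
      (fun t ht => hF.hasDerivAt_iteratedDeriv hJ i (hsub ht))
      ((hF.continuousOn_iteratedDeriv_of_isOpen hJ (i + 1)).mono hsub), pow_succ, mul_assoc]

end HolmgrenData

section Expansion

variable {q f F G : ℝ → ℂ} {b τ a ℓ : ℝ} {α : ℂ} {u : ℝ → ℝ → ℂ}

lemma continuousOn_cauchySeriesTerm (hf : IsNonvanishingSolution q b α f)
    (hF : ContDiffOn ℝ ∞ F (Ioo (-τ) τ)) (hG : ContDiffOn ℝ ∞ G (Ioo (-τ) τ))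
    (j : ℕ) {x : ℝ} (hx : x ∈ Ioo (-b) b) :
    ContinuousOn (fun t => cauchySeriesTerm f α F G j x t) (Ioo (-τ) τ) :=
  (((hF.continuousOn_iteratedDeriv_of_isOpen isOpen_Ioo j).mul continuousOn_const).add
    ((hG.continuousOn_iteratedDeriv_of_isOpen isOpen_Ioo j).mul continuousOn_const)).congr
    fun t _ => cauchySeriesTerm_eq hf.continuousOn hf.ne_zero α F G j hx t

/-- Taylor's formula in time, averaged against the weight: since the weight vanishes to order `N`
at the ends of the interval, the `N` time derivatives are moved onto it, and none of them falls
on `u`. -/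
lemma moment_eq_sum_add_remainder (hℓ : 0 < ℓ) (hJ : Icc a (a + ℓ) ⊆ Ioo (-τ) τ)
    (hf : IsNonvanishingSolution q b α f) (hu : IsClassicalSolution q b τ u)
    (hF : ContDiffOn ℝ ∞ F (Ioo (-τ) τ)) (hG : ContDiffOn ℝ ∞ G (Ioo (-τ) τ))
    (hu0 : ∀ t ∈ Ioo (-τ) τ, u 0 t = F t)
    (hux0 : ∀ t ∈ Ioo (-τ) τ, deriv (fun x => u x t) 0 = G t)
    {x : ℝ} (hx : x ∈ Ioo (-b) b) (N : ℕ) :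
    moment a ℓ (bumpPoly N) (u x) =
      moment a ℓ (bumpPoly N)
        (fun t => ∑ j ∈ Finset.range N, cauchySeriesTerm f α F G j x t) +
      (duhamel f)^[N] (fun y => (-(ℓ : ℂ)⁻¹) ^ N *
        moment a ℓ (Polynomial.derivative^[N] (bumpPoly N)) (u y)) x := by
  have hmono : Ioo (-b) b ×ˢ Icc a (a + ℓ) ⊆ Ioo (-b) b ×ˢ Ioo (-τ) τ := prod_mono_right hJ
  have hcF := fun i => (hF.continuousOn_iteratedDeriv_of_isOpen isOpen_Ioo i).mono hJ
  have hcG := fun i => (hG.continuousOn_iteratedDeriv_of_isOpen isOpen_Ioo i).mono hJ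
  have hstep := eq_sum_add_iterate_duhamel hf.continuousOn hf.ne_zero
    (continuousOn_cosSol hf.continuousOn hf.ne_zero α)
    (continuousOn_formalPower_one hf.continuousOn hf.ne_zero)
    (J := fun i y => (-(ℓ : ℂ)⁻¹) ^ i *
      moment a ℓ (Polynomial.derivative^[i] (bumpPoly N)) (u y))
    (fun i => continuousOn_const.mul
      (continuousOn_moment (K := u) hℓ.le (hu.continuousOn.mono hmono)))
    (A := fun i => (-(ℓ : ℂ)⁻¹) ^ i *
      moment a ℓ (Polynomial.derivative^[i] (bumpPoly N)) F)
    (B := fun i => (-(ℓ : ℂ)⁻¹) ^ i *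
      moment a ℓ (Polynomial.derivative^[i] (bumpPoly N)) G)
    (N := N) (fun i hi y hy => by
      have e : EqOn (fun y => moment a ℓ (Polynomial.derivative^[i] (bumpPoly N)) (deriv (u y)))
          (fun y => (-(ℓ : ℂ)⁻¹) *
            moment a ℓ (Polynomial.derivative^[i + 1] (bumpPoly N)) (u y)) (Ioo (-b) b) :=
        fun z hz => moment_deriv_bumpPoly hℓ hi
          (fun t ht => (hu.differentiable_t z hz t (hJ ht)).hasDerivAt)
          ((continuousOn_slice_right (K := fun z t => deriv (u z) t) hu.continuousOn_t hz).mono hJ)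
      beta_reduce
      rw [moment_eq_duhamel hℓ.le hJ hf hu hu0 hux0 hy, duhamel_congr e hy, duhamel_const_mul,
        duhamel_const_mul, pow_succ]
      change _ = _ + _ * sinSol f y + _
      ring) hx
  simp only [pow_zero, one_mul, Function.iterate_zero, id] at hstep
  rw [hstep, moment_finset_sum (v := fun j t => cauchySeriesTerm f α F G j x t) hℓ.le]
  · congr 1
    refine Finset.sum_congr rfl fun i hi => ?_
    have hi' : i ≤ N := (Finset.mem_range.1 hi).le
    have mF := moment_iteratedDeriv hℓ isOpen_Ioo hJ hF hi' 0
    have mG := moment_iteratedDeriv hℓ isOpen_Ioo hJ hG hi' 0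
    rw [zero_add, iteratedDeriv_zero] at mF mG
    simp only [cauchySeriesTerm_eq hf.continuousOn hf.ne_zero α F G i hx,
      mul_comm (iteratedDeriv i _ _)]
    rw [moment_add (v := fun t => _ * iteratedDeriv i F t) (w := fun t => _ * iteratedDeriv i G t)
      hℓ.le (continuousOn_const.mul (hcF i)) (continuousOn_const.mul (hcG i)),
      moment_const_mul, moment_const_mul, mF, mG]
    change _ + _ * (duhamel f)^[i] (sinSol f) x = _
    ring
  · exact fun i => (continuousOn_cauchySeriesTerm hf hF hG i hx).mono hJ

/-- The powers of `b` in the Holmgren class are matched exactly by the bound for the iterates of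
`duhamel f`, which leaves a geometric series of ratio `(r / b) ^ 2`. -/
lemma exists_norm_cauchySeriesTerm_le {C r : ℝ} (hr0 : 0 ≤ r) (hr : r < b)
    (hf : IsNonvanishingSolution q b α f)
    (hF : F ∈ HolmgrenClass b τ C 0) (hG : G ∈ HolmgrenClass b τ C 0) :
    ∃ M : ℝ, ∀ j : ℕ, ∀ x ∈ Icc (-r) r, ∀ t ∈ Ioo (-τ) τ,
      ‖cauchySeriesTerm f α F G j x t‖ ≤ M * ((r / b) ^ 2) ^ j := by
  have hb : 0 < b := hr0.trans_lt hr
  have hsub : Icc (-r) r ⊆ Ioo (-b) b := Icc_subset_Ioo (by linarith) hr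
  obtain ⟨L, hL0, hL⟩ := exists_norm_le_norm_mul_exp hr
    (fun x hx => (hf.differentiable x hx).hasDerivAt) hf.continuousOn_deriv hf.ne_zero
  have hf0 : ∀ x ∈ Icc (-r) r, f x ≠ 0 := fun x hx => hf.ne_zero x (hsub hx)
  obtain ⟨M₁, hM₁⟩ := (isCompact_Icc (a := -r) (b := r)).exists_bound_of_continuousOn
    ((continuousOn_cosSol hf.continuousOn hf.ne_zero α).mono hsub)
  obtain ⟨M₂, hM₂⟩ := (isCompact_Icc (a := -r) (b := r)).exists_bound_of_continuousOn
    ((continuousOn_formalPower_one hf.continuousOn hf.ne_zero).mono hsub)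
  have h0 : (0 : ℝ) ∈ Icc (-r) r := ⟨by linarith, hr0⟩
  have key : ∀ (j : ℕ) (v : ℝ → ℂ) (g : ℝ → ℂ) (M : ℝ), v ∈ HolmgrenClass b τ C 0 →
      (∀ x ∈ Icc (-r) r, ‖g x‖ ≤ M) → ∀ x ∈ Icc (-r) r, ∀ t ∈ Ioo (-τ) τ,
      ‖iteratedDeriv j v t * (duhamel f)^[j] g x‖ ≤
        (C * M * Real.exp (L * r)) * ((r / b) ^ 2) ^ j := by
    intro j v g M hv hg x hx t ht
    have hM0 : 0 ≤ M := (norm_nonneg _).trans (hg 0 h0)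
    have hv' := hv.2 j t (by simpa using ht)
    have hx' : |x| ≤ r := abs_le.2 hx
    have hd := norm_iterate_duhamel_le hM0 hL hf0 hL0 hg j hx
    have hd' : ‖(duhamel f)^[j] g x‖ ≤
        M / (2 * j).factorial * r ^ (2 * j) * Real.exp (L * r) := hd.trans (by gcongr)
    rw [norm_mul]
    refine (mul_le_mul hv' hd' (norm_nonneg _) ((norm_nonneg _).trans hv')).trans_eq ?_
    have : ((2 * j).factorial : ℝ) ≠ 0 := by positivity
    rw [← pow_mul, div_pow]
    field_simp
  refine ⟨C * M₁ * Real.exp (L * r) + C * M₂ * Real.exp (L * r), fun j x hx t ht => ?_⟩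
  rw [cauchySeriesTerm_eq hf.continuousOn hf.ne_zero α F G j (hsub hx), add_mul]
  exact (norm_add_le _ _).trans (add_le_add (key j F _ M₁ hF hM₁ x hx t ht)
    (key j G _ M₂ hG hM₂ x hx t ht))

/-- The remainder is negligible against the mass of the weight: `N!` from Rodrigues' formula loses
against the `(2N)!` of the iterates of `duhamel f`, whatever the length `ℓ` of the interval. -/
lemma tendsto_remainder {r : ℝ} (hr : r < b) (hℓ : 0 < ℓ)
    (hJ : Icc a (a + ℓ) ⊆ Ioo (-τ) τ)
    (hf : IsNonvanishingSolution q b α f) (hu : IsClassicalSolution q b τ u)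
    {x : ℝ} (hx : x ∈ Icc (-r) r) :
    Tendsto (fun N : ℕ => (∫ s in (0 : ℝ)..1, (s * (1 - s)) ^ N)⁻¹ *
      ‖(duhamel f)^[N] (fun y => (-(ℓ : ℂ)⁻¹) ^ N *
        moment a ℓ (Polynomial.derivative^[N] (bumpPoly N)) (u y)) x‖) atTop (𝓝 0) := by
  have hsub : Icc (-r) r ⊆ Ioo (-b) b := Icc_subset_Ioo (by linarith) hr
  obtain ⟨L, hL0, hL⟩ := exists_norm_le_norm_mul_exp hr
    (fun x hx => (hf.differentiable x hx).hasDerivAt) hf.continuousOn_deriv hf.ne_zero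
  have hf0 : ∀ x ∈ Icc (-r) r, f x ≠ 0 := fun x hx => hf.ne_zero x (hsub hx)
  obtain ⟨M, hM⟩ := ((isCompact_Icc (a := -r) (b := r)).prod
    (isCompact_Icc (a := a) (b := a + ℓ))).exists_bound_of_continuousOn
    (hu.continuousOn.mono (prod_mono hsub hJ))
  have hM0 : 0 ≤ M := (norm_nonneg _).trans (hM (x, a) ⟨hx, le_rfl, by linarith⟩)
  have hlim := (FloorSemiring.tendsto_pow_div_factorial_atTop
    (16 / 3 * ℓ⁻¹ * 8 * |x| ^ 2)).const_mul (2 * M * Real.exp (L * |x|))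
  rw [mul_zero] at hlim
  refine squeeze_zero (fun N => mul_nonneg (inv_nonneg.2
    (le_trans (by positivity) (le_integral_bump N))) (norm_nonneg _)) (fun N => ?_) hlim
  have hB : ∀ y ∈ Icc (-r) r, ‖(-(ℓ : ℂ)⁻¹) ^ N *
      moment a ℓ (Polynomial.derivative^[N] (bumpPoly N)) (u y)‖ ≤
      ℓ⁻¹ ^ N * (M * (N.factorial * 8 ^ N)) := fun y hy => by
    rw [norm_mul, norm_pow, norm_neg, norm_inv, Complex.norm_real, Real.norm_of_nonneg hℓ.le]
    gcongr
    exact norm_moment_le hℓ.le (fun t ht => hM (y, t) ⟨hy, ht⟩)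
      fun s hs => norm_eval_iterate_derivative_bumpPoly_le N hs
  have hZ : (∫ s in (0 : ℝ)..1, (s * (1 - s)) ^ N)⁻¹ ≤ ((3 / 16 : ℝ) ^ N / 2)⁻¹ :=
    inv_anti₀ (by positivity) (le_integral_bump N)
  have hfac : (N.factorial : ℝ) / (2 * N).factorial ≤ 1 / N.factorial := by
    rw [div_le_div_iff₀ (by positivity) (by positivity), one_mul, two_mul]
    exact_mod_cast Nat.le_of_dvd (Nat.factorial_pos _)
      (Nat.factorial_mul_factorial_dvd_factorial_add N N)
  calc _ ≤ ((3 / 16 : ℝ) ^ N / 2)⁻¹ * (ℓ⁻¹ ^ N * (M * (N.factorial * 8 ^ N)) /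
          (2 * N).factorial * |x| ^ (2 * N) * Real.exp (L * |x|)) :=
        mul_le_mul hZ (norm_iterate_duhamel_le (by positivity) hL hf0 hL0 hB N hx) (norm_nonneg _)
          (by positivity)
    _ = 2 * M * Real.exp (L * |x|) * ((16 / 3 * ℓ⁻¹ * 8 * |x| ^ 2) ^ N *
          ((N.factorial : ℝ) / (2 * N).factorial)) := by
        rw [inv_div, ← inv_inv ((3 / 16 : ℝ) ^ N), ← inv_pow, mul_pow, mul_pow, mul_pow, ← pow_mul]
        norm_num
        ring
    _ ≤ 2 * M * Real.exp (L * |x|) * ((16 / 3 * ℓ⁻¹ * 8 * |x| ^ 2) ^ N * (1 / N.factorial)) := by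
        gcongr
    _ = _ := by rw [mul_one_div]

end Expansion

/-! ### The sum of the series -/

/-- A uniform limit of the partial sums agrees with the solution: the two have asymptotically equal
averages against weights concentrating at any prescribed time. -/
lemma eq_of_tendstoUniformlyOn {q f F G : ℝ → ℂ} {b τ r x : ℝ} {α : ℂ} {u : ℝ → ℝ → ℂ} {S : ℝ → ℂ}
    (hr : r < b) (hf : IsNonvanishingSolution q b α f) (hu : IsClassicalSolution q b τ u)
    (hF : ContDiffOn ℝ ∞ F (Ioo (-τ) τ)) (hG : ContDiffOn ℝ ∞ G (Ioo (-τ) τ))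
    (hu0 : ∀ t ∈ Ioo (-τ) τ, u 0 t = F t)
    (hux0 : ∀ t ∈ Ioo (-τ) τ, deriv (fun x => u x t) 0 = G t) (hx : x ∈ Icc (-r) r)
    (hS : TendstoUniformlyOn
      (fun (N : ℕ) t => ∑ j ∈ Finset.range N, cauchySeriesTerm f α F G j x t) S atTop
      (Ioo (-τ) τ)) {t₀ : ℝ} (ht₀ : t₀ ∈ Ioo (-τ) τ) : S t₀ = u x t₀ := by
  have hx' : x ∈ Ioo (-b) b := Icc_subset_Ioo (by linarith) hr hx
  obtain ⟨δ, hδ, hball⟩ := Metric.nhds_basis_closedBall.mem_iff.1 (isOpen_Ioo.mem_nhds ht₀)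
  rw [Real.closedBall_eq_Icc, show t₀ + δ = t₀ - δ + 2 * δ by ring] at hball
  have hℓ : 0 < 2 * δ := by positivity
  have hcu : ContinuousOn (u x) (Icc (t₀ - δ) (t₀ - δ + 2 * δ)) :=
    (continuousOn_slice_right hu.continuousOn hx').mono hball
  have hcp : ∀ N : ℕ, ContinuousOn
      (fun t => ∑ j ∈ Finset.range N, cauchySeriesTerm f α F G j x t) (Ioo (-τ) τ) := fun N =>
    continuousOn_finsetSum _ fun j _ => continuousOn_cauchySeriesTerm hf hF hG j hx'
  have hcS : ContinuousOn S (Ioo (-τ) τ) := hS.continuousOn (Frequently.of_forall hcp)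
  have hneg : ∀ {v : ℝ → ℂ}, ContinuousOn v (Icc (t₀ - δ) (t₀ - δ + 2 * δ)) →
      ContinuousOn (fun t => (-1) * v t) (Icc (t₀ - δ) (t₀ - δ + 2 * δ)) :=
    fun hv => continuousOn_const.mul hv
  have hlim := (tendsto_moment_bumpPoly hℓ.le (v := fun t => u x t + (-1) * S t)
    (hcu.add (hneg (hcS.mono hball)))).norm
  rw [show t₀ - δ + 2 * δ * (1 / 2) = t₀ by ring] at hlim
  have hzero : ‖u x t₀ + (-1) * S t₀‖ ≤ 0 := by
    refine le_of_forall_pos_le_add fun ε hε => ?_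
    have hrem := (tendsto_remainder hr hℓ hball hf hu hx).add_const ε
    refine le_of_tendsto_of_tendsto hlim hrem ?_
    filter_upwards [Metric.tendstoUniformlyOn_iff.1 hS ε hε] with N hN
    have hZ : 0 < ∫ s in (0 : ℝ)..1, (s * (1 - s)) ^ N :=
      lt_of_lt_of_le (by positivity) (le_integral_bump N)
    have hdiff : ‖moment (t₀ - δ) (2 * δ) (bumpPoly N) (fun t =>
        (∑ j ∈ Finset.range N, cauchySeriesTerm f α F G j x t) + (-1) * S t)‖ ≤
        ε * ∫ s in (0 : ℝ)..1, (s * (1 - s)) ^ N := by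
      refine norm_moment_bumpPoly_le hℓ.le (fun t ht => ?_) N
      have := hN t (hball ht)
      rw [dist_comm, dist_eq_norm] at this
      rw [neg_one_mul, ← sub_eq_add_neg]
      exact this.le
    rw [moment_add hℓ.le ((hcp N).mono hball) (hneg (hcS.mono hball))] at hdiff
    rw [moment_add hℓ.le hcu (hneg (hcS.mono hball)),
      moment_eq_sum_add_remainder hℓ hball hf hu hF hG hu0 hux0 hx' N, add_right_comm, norm_smul,
      norm_inv, Real.norm_of_nonneg hZ.le]
    calc _ ≤ (∫ s in (0 : ℝ)..1, (s * (1 - s)) ^ N)⁻¹ *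
          (ε * (∫ s in (0 : ℝ)..1, (s * (1 - s)) ^ N) + _) := by
          refine mul_le_mul_of_nonneg_left ((norm_add_le _ _).trans (add_le_add_left hdiff _))
            (inv_nonneg.2 hZ.le)
      _ = _ := by
          rw [mul_add, mul_comm ε, inv_mul_cancel_left₀ hZ.ne', add_comm]
  have := norm_le_zero_iff.1 hzero
  linear_combination -this

theorem mainTheorem2 (b τ C : ℝ) (hb : 0 < b) (hτ : 0 < τ) (hC : 0 < C)
    (q : ℝ → ℂ) (hq : ContinuousOn q (Icc (-b) b))
    (α : ℂ) (f : ℝ → ℂ) (hf : IsNonvanishingSolution q b α f)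
    (F G : ℝ → ℂ) (hF : F ∈ HolmgrenClass b τ C 0) (hG : G ∈ HolmgrenClass b τ C 0)
    (u : ℝ → ℝ → ℂ) (hu : IsClassicalSolution q b τ u)
    (hu0 : ∀ t ∈ Ioo (-τ) τ, u 0 t = F t)
    (hux0 : ∀ t ∈ Ioo (-τ) τ, deriv (fun x => u x t) 0 = G t) :
    ∀ r : ℝ, r < b →
      (∀ x ∈ Icc (-r) r, ∀ t ∈ Ioo (-τ) τ,
        Summable (fun j : ℕ => ‖cauchySeriesTerm f α F G j x t‖)) ∧
      TendstoUniformlyOn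
        (fun (N : ℕ) (p : ℝ × ℝ) => ∑ j ∈ Finset.range N, cauchySeriesTerm f α F G j p.1 p.2)
        (fun p : ℝ × ℝ => u p.1 p.2) atTop (Icc (-r) r ×ˢ Ioo (-τ) τ) := by

  intro r hr
  rcases lt_or_ge r 0 with hr0 | hr0
  · simp [Icc_eq_empty (by linarith : ¬ -r ≤ r), tendstoUniformlyOn_empty]
  have hF' : ContDiffOn ℝ ∞ F (Ioo (-τ) τ) := by simpa using hF.1
  have hG' : ContDiffOn ℝ ∞ G (Ioo (-τ) τ) := by simpa using hG.1
  obtain ⟨M, hM⟩ := exists_norm_cauchySeriesTerm_le (α := α) hr0 hr hf hF hG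
  have hratio : (r / b) ^ 2 < 1 :=
    pow_lt_one₀ (by positivity) ((div_lt_one hb).2 hr) two_ne_zero
  have hsum : Summable fun j : ℕ => M * ((r / b) ^ 2) ^ j :=
    (summable_geometric_of_lt_one (by positivity) hratio).mul_left M
  refine ⟨fun x hx t ht => hsum.of_nonneg_of_le (fun _ => norm_nonneg _) fun j => hM j x hx t ht,
    ?_⟩
  refine (tendstoUniformlyOn_tsum_nat hsum (f := fun j (p : ℝ × ℝ) =>
    cauchySeriesTerm f α F G j p.1 p.2) fun j p hp => hM j p.1 hp.1 p.2 hp.2).congr_right ?_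
  rintro ⟨x, t⟩ ⟨hx, ht⟩
  exact eq_of_tendstoUniformlyOn hr hf hu hF' hG' hu0 hux0 hx
    (tendstoUniformlyOn_tsum_nat hsum fun j t ht => hM j x hx t ht) ht
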